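/- Let $K$ be an arbitrary commutative ring and let $m,n$ be non-negative integers. Let $K[V^m]$ be the polynomial ring over $K$ in the $mn$ variables $x(i)_j$ ($1\le i\le m$, $1\le j\le n$), on which the symmetric group $S_n$ acts by $K$-algebra automorphisms via $\pi\cdot x(i)_j=x(i)_{\pi(j)}$, and let $K[V^m]^{S_n}$ be the subalgebra of invariants. For $\alpha=(\alpha_1,\ldots,\alpha_m)\in\mathbb{Z}_{\ge 0}^m$, $w=x(1)^{\alpha_1}\cdots x(m)^{\alpha_m}$ and $0\le r\le n$ put \[\sigma_r(w)=\sum_{1\le j_1<\cdots<j_r\le n} w_{\langle j_1\rangle}\cdots w_{\langle j_r\rangle},\qquad w_{\langle j\rangle}=x(1)_j^{\alpha_1}\cdots x(m)_j^{\alpha_m}.\] Then the $K$-algebra $K[V^m]^{S_n}$ is generated by the elements $\sigma_n(x(i))$, $i\in\{1,\ldots,m\}$, together with the elements $\sigma_r(x(1)^{\alpha_1}\cdots x(m)^{\alpha_m})$, where $r\in\{1,\ldots,n\}$, $\alpha_j<n/r$ for all $j=1,\ldots,m$, and $\gcd(\alpha_1,\ldots,\alpha_m)=1$. In particular, the $K$-algebra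 $K[V^m]^{S_n}$ is generated by its homogeneous elements of (total) degree at most $\max\{m(n-1),n\}$. -/

import Mathlib

noncomputable section

namespace Multisymmetric

open MvPolynomial

/-- The coordinate ring `K[V^m]` with `V = K^n`: the polynomial ring over `K` in the `m * n`
variables `x(i)_j = X (i, j)`, where `X (i, j)` is the `j`-th coordinate of the `i`-th vector. -/
abbrev CoordRing (K : Type*) [CommRing K] (m n : ℕ) : Type _ :=
  MvPolynomial (Fin m × Fin n) K

/-- The diagonal action of a permutation `π` of `{1, …, n}` on `K[V^m]`:
the `K`-algebra endomorphism with `x(i)_j ↦ x(i)_{π j}`. -/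
def permAct (K : Type*) [CommRing K] (m n : ℕ) (π : Equiv.Perm (Fin n)) :
    CoordRing K m n →ₐ[K] CoordRing K m n :=
  rename (fun p : Fin m × Fin n => (p.1, π p.2))

/-- The algebra `K[V^m]^{S_n}` of multisymmetric polynomials. -/
def invariants (K : Type*) [CommRing K] (m n : ℕ) : Subalgebra K (CoordRing K m n) where
  carrier := {f | ∀ π : Equiv.Perm (Fin n), permAct K m n π f = f}
  mul_mem' := fun {f g} hf hg π => by rw [map_mul, hf π, hg π]
  add_mem' := fun {f g} hf hg π => by rw [map_add, hf π, hg π]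
  algebraMap_mem' := fun c π => (permAct K m n π).commutes c

/-- For the monomial `w = x(1)^{α_1} ⋯ x(m)^{α_m}`, the element
`w_⟨j⟩ = x(1)_j^{α_1} ⋯ x(m)_j^{α_m}` of `K[V^m]`. -/
def monomialAt (K : Type*) [CommRing K] (m n : ℕ) (α : Fin m → ℕ) (j : Fin n) :
    CoordRing K m n :=
  ∏ i : Fin m, X (i, j) ^ α i

/-- For the monomial `w = x(1)^{α_1} ⋯ x(m)^{α_m}`, the multisymmetric polynomial
`σ_r(w) = ∑_{j_1 < ⋯ < j_r} w_⟨j_1⟩ ⋯ w_⟨j_r⟩`. -/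
def sigma (K : Type*) [CommRing K] (m n : ℕ) (r : ℕ) (α : Fin m → ℕ) : CoordRing K m n :=
  ∑ s ∈ Finset.powersetCard r (Finset.univ : Finset (Fin n)), ∏ j ∈ s, monomialAt K m n α j

end Multisymmetric

end

/-! The engine is the multiplicative map `norm`, P ↦ ∏_j P((w_t)_⟨j⟩ X_t), on integral polynomials
in auxiliary variables. On a binomial 1 + c X^ν it gives ∑_r c^r σ_r(w^ν) X^{rν}, and a polynomial
with constant term 1 is a product of binomials up to any prescribed order
(`exists_binomialProduct`). Hence all coefficients of norms of such polynomials are polynomials in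
the σ_r. For P = 1 + ∑ X_α with generic w these coefficients are the orbit sums of monomials, so the
σ_r(w) generate the invariants over any K (`invariants_le_of_sigma_mem`).

To cut the generators down, work modulo the algebra generated by the σ of smaller degree. Newton's
identities over ℤ give σ_r(w^h) ≡ ± h σ_{hr}(w), so only primitive w matter (`sigma_smul_sub_mem`).

It remains to remove σ_g(w) when n ≤ g α_i and w involves another vector. Fix a prime p and write g
= p^s g' with p ∤ g'. Take P = 1 - X_0 + X_1, with X_0 carrying x(i) and X_1 carrying
(w/x(i)^{α_i})^{g'}. The norm of P has degree at most n, so its coefficient at X_0^{g α_i} X_1^{p^s}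
vanishes. By the binomial factorization that coefficient is also ≡ N σ_g(w). Modulo p, N is ± g'
times a coefficient of the logarithmic derivative X/(1 - X), hence nonzero (`exists_mul_sigma_mem`).
As p varies, the integers N generate the unit ideal of ℤ, so σ_g(w) itself is decomposable. -/

namespace Multisymmetric

open MvPolynomial

/-! ### Newton's identities: elementary symmetric polynomials of powers -/

section Univariate

variable (n : ℕ)

/-- The subalgebra of `ℤ[x_1, …, x_n]` generated by the elementary symmetric polynomials of
degree less than `d`. -/
noncomputable def esymmBelow (d : ℕ) : Subalgebra ℤ (MvPolynomial (Fin n) ℤ) :=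
  Algebra.adjoin ℤ {f | ∃ i < d, f = esymm (Fin n) ℤ i}

variable {n}

theorem esymm_mem_esymmBelow {i d : ℕ} (h : i < d) :
    esymm (Fin n) ℤ i ∈ esymmBelow n d :=
  Algebra.subset_adjoin ⟨i, h, rfl⟩

theorem esymmBelow_mono {d e : ℕ} (h : d ≤ e) : esymmBelow n d ≤ esymmBelow n e :=
  Algebra.adjoin_mono fun _ ⟨i, hi, hf⟩ => ⟨i, hi.trans_le h, hf⟩

theorem neg_one_pow_mem {R A : Type*} [CommRing R] [CommRing A] [Algebra R A]
    (S : Subalgebra R A) (k : ℕ) : (-1 : A) ^ k ∈ S :=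
  pow_mem (neg_mem (one_mem S)) k

theorem psum_sub_mem_esymmBelow (k : ℕ) (hk : 0 < k) :
    psum (Fin n) ℤ k - (-1) ^ (k + 1) * (k : MvPolynomial (Fin n) ℤ) * esymm (Fin n) ℤ k ∈
      esymmBelow n k := by
  induction k using Nat.strong_induction_on with
  | _ k ih =>
    rw [psum_eq_mul_esymm_sub_sum _ _ k hk, sub_sub_cancel_left]
    refine neg_mem (sum_mem fun a ha => ?_)
    simp only [Finset.mem_filter, Finset.HasAntidiagonal.mem_antidiagonal, Set.mem_Ioo] at ha
    refine mul_mem (mul_mem (neg_one_pow_mem _ _) (esymm_mem_esymmBelow ha.2.2)) ?_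
    have h := esymmBelow_mono (n := n) (show a.2 ≤ k by omega) (ih a.2 (by omega) (by omega))
    rw [← sub_add_cancel (psum (Fin n) ℤ a.2)
      ((-1) ^ (a.2 + 1) * (a.2 : MvPolynomial (Fin n) ℤ) * esymm (Fin n) ℤ a.2)]
    exact add_mem h (mul_mem (mul_mem (neg_one_pow_mem _ _) (natCast_mem _ _))
      (esymm_mem_esymmBelow (by omega)))

theorem esymmBelow_eq_map_supported (d : ℕ) :
    esymmBelow n d = (supported ℤ {i : Fin n | (i : ℕ) + 1 < d}).map
      (aeval fun i : Fin n => esymm (Fin n) ℤ (i + 1)) := by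
  rw [supported_eq_adjoin_X, AlgHom.map_adjoin]
  apply le_antisymm
  · refine Algebra.adjoin_le ?_
    rintro _ ⟨i, hi, rfl⟩
    rcases Nat.eq_zero_or_pos i with rfl | h0
    · simp
    by_cases hn : i ≤ n
    · refine Algebra.subset_adjoin ⟨X ⟨i - 1, by omega⟩, ⟨⟨i - 1, by omega⟩, ?_, rfl⟩, ?_⟩
      · simp only [Set.mem_ofPred_eq]; omega
      · simp only [aeval_X]
        congr 1; omega
    · rw [esymm, Finset.powersetCard_eq_empty.2 (by simpa using hn)]
      simp
  · refine Algebra.adjoin_mono ?_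
    rintro _ ⟨_, ⟨i, hi, rfl⟩, rfl⟩
    exact ⟨i + 1, hi, by simp⟩

/-- The symmetric polynomials form a polynomial ring over ℤ on the elementary ones, where
multiplication by a nonzero integer does not change which variables occur. This permits division by
r in Newton's identity. -/
theorem mem_esymmBelow_of_natCast_mul_mem {d r : ℕ} (hr : r ≠ 0) {f : MvPolynomial (Fin n) ℤ}
    (hf : f.IsSymmetric) (h : (r : MvPolynomial (Fin n) ℤ) * f ∈ esymmBelow n d) :
    f ∈ esymmBelow n d := by
  obtain ⟨P, hP⟩ := esymmAlgHom_surjective (σ := Fin n) ℤ (n := n) (by simp) ⟨f, hf⟩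
  replace hP : aeval (fun i : Fin n => esymm (Fin n) ℤ (i + 1)) P = f := by
    rw [← esymmAlgHom_apply, hP]
  have hinj : Function.Injective (aeval (R := ℤ) fun i : Fin n => esymm (Fin n) ℤ (i + 1)) := by
    intro a b hab
    apply esymmAlgHom_injective (σ := Fin n) ℤ (n := n) (by simp)
    apply Subtype.ext
    rwa [esymmAlgHom_apply, esymmAlgHom_apply]
  rw [esymmBelow_eq_map_supported] at h ⊢
  obtain ⟨Q, hQ, hQf⟩ := h
  have hQP : Q = (r : MvPolynomial (Fin n) ℤ) * P := by
    apply hinj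
    rw [map_mul, map_natCast, hP]
    exact hQf
  refine ⟨P, ?_, hP⟩
  have hv : P.vars = Q.vars := by
    rw [hQP, ← map_natCast (C (σ := Fin n) (R := ℤ)), vars_C_mul (r : ℤ) (by exact_mod_cast hr)]
  exact mem_supported.2 (hv ▸ mem_supported.1 hQ)

theorem expand_psum (h k : ℕ) :
    expand h (psum (Fin n) ℤ k) = psum (Fin n) ℤ (h * k) := by
  simp [psum, pow_mul]

theorem isSymmetric_expand {f : MvPolynomial (Fin n) ℤ} (hf : f.IsSymmetric) (h : ℕ) :
    (expand h f).IsSymmetric := fun e => by rw [rename_expand, hf e]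

/-- The elementary symmetric polynomial of the `h`-th powers, modulo elementary symmetric
polynomials of lower degree. -/
theorem expand_esymm_sub_mem_esymmBelow (h r : ℕ) (hh : 0 < h) (hr : 0 < r) :
    expand h (esymm (Fin n) ℤ r) -
      (-1) ^ (h * r + r) * (h : MvPolynomial (Fin n) ℤ) * esymm (Fin n) ℤ (h * r) ∈
      esymmBelow n (h * r) := by
  induction r using Nat.strong_induction_on with
  | _ r ih =>
    -- Newton's identity in the h-th powers only yields r times the claim.
    refine mem_esymmBelow_of_natCast_mul_mem hr.ne' ?_ ?_
    · refine IsSymmetric.sub (isSymmetric_expand (esymm_isSymmetric _ _ _) h) ?_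
      refine IsSymmetric.mul (fun e => ?_) (esymm_isSymmetric _ _ _)
      simp
    have h1 := congrArg (expand h) (psum_eq_mul_esymm_sub_sum (Fin n) ℤ r hr)
    rw [expand_psum] at h1
    simp only [map_sub, map_mul, map_pow, map_neg, map_one, map_natCast] at h1
    have h2 := psum_sub_mem_esymmBelow (n := n) (h * r) (by positivity)
    have h3 : expand h (∑ a ∈ Finset.HasAntidiagonal.antidiagonal r with a.1 ∈ Set.Ioo 0 r,
        (-1) ^ a.1 * esymm (Fin n) ℤ a.1 * psum (Fin n) ℤ a.2) ∈ esymmBelow n (h * r) := by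
      rw [map_sum]
      refine sum_mem fun a ha => ?_
      simp only [Finset.mem_filter, Finset.HasAntidiagonal.mem_antidiagonal, Set.mem_Ioo] at ha
      have ha1 : h * a.1 < h * r := Nat.mul_lt_mul_of_pos_left ha.2.2 hh
      have ha2 : h * a.2 < h * r := Nat.mul_lt_mul_of_pos_left (by omega) hh
      rw [map_mul, map_mul, map_pow, map_neg, map_one, expand_psum]
      refine mul_mem (mul_mem (neg_one_pow_mem _ _) ?_) ?_
      · have := esymmBelow_mono (n := n) ha1.le (ih a.1 ha.2.2 ha.2.1)
        rw [← sub_add_cancel (expand h (esymm (Fin n) ℤ a.1))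
          ((-1) ^ (h * a.1 + a.1) * (h : MvPolynomial (Fin n) ℤ) * esymm (Fin n) ℤ (h * a.1))]
        exact add_mem this (mul_mem (mul_mem (neg_one_pow_mem _ _) (natCast_mem _ _))
          (esymm_mem_esymmBelow ha1))
      · have := esymmBelow_mono (n := n) ha2.le
          (psum_sub_mem_esymmBelow (n := n) (h * a.2) (Nat.mul_pos hh (by omega)))
        rw [← sub_add_cancel (psum (Fin n) ℤ (h * a.2))
          ((-1) ^ (h * a.2 + 1) * ((h * a.2 : ℕ) : MvPolynomial (Fin n) ℤ) *
            esymm (Fin n) ℤ (h * a.2))]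
        exact add_mem this (mul_mem (mul_mem (neg_one_pow_mem _ _) (natCast_mem _ _))
          (esymm_mem_esymmBelow ha2))
    have hs : ((-1 : MvPolynomial (Fin n) ℤ) ^ (r + 1)) * (-1) ^ (r + 1) = 1 := by
      rw [← mul_pow]; simp
    have h4 : (r : MvPolynomial (Fin n) ℤ) * (expand h (esymm (Fin n) ℤ r) -
        (-1) ^ (h * r + r) * (h : MvPolynomial (Fin n) ℤ) * esymm (Fin n) ℤ (h * r)) =
        (-1) ^ (r + 1) * ((psum (Fin n) ℤ (h * r) -
          (-1) ^ (h * r + 1) * ((h * r : ℕ) : MvPolynomial (Fin n) ℤ) *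
            esymm (Fin n) ℤ (h * r)) +
          expand h (∑ a ∈ Finset.HasAntidiagonal.antidiagonal r with a.1 ∈ Set.Ioo 0 r,
            (-1) ^ a.1 * esymm (Fin n) ℤ a.1 * psum (Fin n) ℤ a.2)) := by
      rw [h1]
      push_cast
      simp only [pow_add] at hs ⊢
      linear_combination (-(r : MvPolynomial (Fin n) ℤ) * expand h (esymm (Fin n) ℤ r)) * hs
    rw [h4]
    exact mul_mem (neg_one_pow_mem _ _) (add_mem h2 h3)

end Univariate

/-! ### Factorization into binomials up to high order -/

section Factorization

variable {τ : Type*}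

/-- The multiplicative monoid generated by the binomials `1 + c X^ν` with `ν ≠ 0`. -/
noncomputable def binomialProducts (τ : Type*) : Submonoid (MvPolynomial τ ℤ) :=
  Submonoid.closure {f | ∃ (ν : τ →₀ ℕ) (c : ℤ), ν ≠ 0 ∧ f = 1 + monomial ν c}

/-- Products of two or more `f i` lie in I^(2D), which is contained in I^(D+1). -/
theorem prod_one_add_sub_mem {R ι : Type*} [CommRing R] (I : Ideal R) (s : Finset ι) (f : ι → R)
    (D : ℕ) (hD : 0 < D) (hf : ∀ i ∈ s, f i ∈ I ^ D) :
    ∏ i ∈ s, (1 + f i) - (1 + ∑ i ∈ s, f i) ∈ I ^ (D + 1) := by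
  classical
  induction s using Finset.induction_on with
  | empty => simp
  | insert a s ha ih =>
    rw [Finset.prod_insert ha, Finset.sum_insert ha]
    have h1 := ih fun i hi => hf i (Finset.mem_insert_of_mem hi)
    have h2 : f a * ∑ i ∈ s, f i ∈ I ^ (D + 1) := by
      refine Ideal.pow_le_pow_right (show D + 1 ≤ D + D by omega) ?_
      rw [pow_add]
      exact Ideal.mul_mem_mul (hf a (Finset.mem_insert_self _ _))
        (sum_mem fun i hi => hf i (Finset.mem_insert_of_mem hi))
    have : (1 + f a) * ∏ i ∈ s, (1 + f i) - (1 + (f a + ∑ i ∈ s, f i)) =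
        (1 + f a) * (∏ i ∈ s, (1 + f i) - (1 + ∑ i ∈ s, f i)) + f a * ∑ i ∈ s, f i := by ring
    rw [this]
    exact add_mem (Ideal.mul_mem_left _ _ h1) h2

theorem mem_idealOfVars_of_coeff_zero {P : MvPolynomial τ ℤ} (hP : coeff 0 P = 0) :
    P ∈ idealOfVars τ ℤ := by
  rw [← pow_one (idealOfVars τ ℤ), mem_pow_idealOfVars_iff']
  intro x hx
  have : x = 0 := by
    rw [← Finsupp.degree_eq_zero_iff]; omega
  rw [this, hP]

/-- Every polynomial with constant term `1` is, up to terms of high degree, a product of binomials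
`1 + c X^ν`. -/
theorem exists_binomialProduct (P : MvPolynomial τ ℤ) (hP : coeff 0 P = 1) (D : ℕ) :
    ∃ Q ∈ binomialProducts τ, P - Q ∈ idealOfVars τ ℤ ^ (D + 1) := by
  classical
  induction D with
  | zero =>
    refine ⟨1, one_mem _, ?_⟩
    rw [zero_add, pow_one]
    exact mem_idealOfVars_of_coeff_zero (by simp [hP])
  | succ D ih =>
    obtain ⟨Q, hQ, hPQ⟩ := ih
    set E := P - Q with hE
    let s := E.support.filter fun ν => ν.degree = D + 1
    -- One binomial for each term of the error in its lowest possible degree D + 1; multiplying by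
    -- `B` cancels that layer.
    let B := ∏ ν ∈ s, (1 + monomial ν (coeff ν E))
    have hB : B - (1 + ∑ ν ∈ s, monomial ν (coeff ν E)) ∈ idealOfVars τ ℤ ^ (D + 1 + 1) := by
      refine prod_one_add_sub_mem _ _ _ _ (by omega) fun ν hν => ?_
      simp only [s, Finset.mem_filter, mem_support_iff] at hν
      rw [monomial_mem_pow_idealOfVars_iff _ _ hν.1, hν.2]
    have hs : E - ∑ ν ∈ s, monomial ν (coeff ν E) ∈ idealOfVars τ ℤ ^ (D + 1 + 1) := by
      rw [mem_pow_idealOfVars_iff']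
      intro x hx
      rw [coeff_sub, coeff_sum]
      simp only [coeff_monomial]
      rw [Finset.sum_ite_eq' s x]
      rcases Nat.lt_or_ge x.degree (D + 1) with h | h
      · have h0 := (mem_pow_idealOfVars_iff' _ _).1 hPQ x h
        simp [h0]
      · split_ifs with hxs
        · simp
        · have hx' : x.degree = D + 1 := by omega
          simp only [s, Finset.mem_filter, mem_support_iff, not_and, hx', not_true_eq_false,
            imp_false, not_not] at hxs
          simp [hxs]
    have hQ1 : Q - 1 ∈ idealOfVars τ ℤ := by
      have h1 : P - 1 ∈ idealOfVars τ ℤ := mem_idealOfVars_of_coeff_zero (by simp [hP])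
      have h2 : E ∈ idealOfVars τ ℤ := Ideal.pow_le_self (by omega) hPQ
      have : Q - 1 = (P - 1) - E := by rw [hE]; ring
      rw [this]
      exact sub_mem h1 h2
    have hS : ∑ ν ∈ s, monomial ν (coeff ν E) ∈ idealOfVars τ ℤ ^ (D + 1) := by
      have := sub_mem hPQ (Ideal.pow_le_pow_right (show D + 1 ≤ D + 1 + 1 by omega) hs)
      rwa [sub_sub_cancel] at this
    refine ⟨Q * B, mul_mem hQ (prod_mem fun ν hν => Submonoid.subset_closure
      ⟨ν, coeff ν E, ?_, rfl⟩), ?_⟩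
    · rintro rfl
      simp [s] at hν
    · have h3 : (Q - 1) * ∑ ν ∈ s, monomial ν (coeff ν E) ∈ idealOfVars τ ℤ ^ (D + 1 + 1) := by
        rw [pow_succ' _ (D + 1)]
        exact Ideal.mul_mem_mul hQ1 hS
      have : P - Q * B = (E - ∑ ν ∈ s, monomial ν (coeff ν E)) -
          Q * (B - (1 + ∑ ν ∈ s, monomial ν (coeff ν E))) -
          (Q - 1) * ∑ ν ∈ s, monomial ν (coeff ν E) := by rw [hE]; ring
      rw [this]
      exact sub_mem (sub_mem hs (Ideal.mul_mem_left _ _ hB)) h3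

end Factorization

/-! ### The norm and its values on binomials -/

section Norm

variable {K : Type*} [CommRing K] {m n : ℕ} {τ : Type*}

theorem monomialAt_add (α β : Fin m → ℕ) (j : Fin n) :
    monomialAt K m n (α + β) j = monomialAt K m n α j * monomialAt K m n β j := by
  simp [monomialAt, pow_add, Finset.prod_mul_distrib]

theorem monomialAt_zero (j : Fin n) : monomialAt K m n 0 j = 1 := by
  simp [monomialAt]

theorem monomialAt_smul (k : ℕ) (α : Fin m → ℕ) (j : Fin n) :
    monomialAt K m n (k • α) j = monomialAt K m n α j ^ k := by
  simp [monomialAt, Finset.prod_pow, mul_comm k, pow_mul]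

/-- The exponent vector of `w^ν = ∏ w_t^{ν_t}` where `w_t` is the monomial with exponent `w t`. -/
def weight (w : τ → Fin m → ℕ) (ν : τ →₀ ℕ) : Fin m → ℕ := ν.sum fun t k => k • w t

theorem weight_add (w : τ → Fin m → ℕ) (ν κ : τ →₀ ℕ) :
    weight w (ν + κ) = weight w ν + weight w κ := by
  classical
  exact Finsupp.sum_add_index' (fun _ => zero_smul _ _) fun _ _ _ => add_smul _ _ _

theorem weight_zero (w : τ → Fin m → ℕ) : weight w 0 = 0 := Finsupp.sum_zero_index

theorem weight_single (w : τ → Fin m → ℕ) (t : τ) (k : ℕ) :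
    weight w (Finsupp.single t k) = k • w t := by
  simp [weight]

theorem weight_smul (w : τ → Fin m → ℕ) (r : ℕ) (ν : τ →₀ ℕ) :
    weight w (r • ν) = r • weight w ν := by
  induction r with
  | zero => simp [weight_zero]
  | succ r ih => rw [succ_nsmul, weight_add, ih, succ_nsmul]

variable (K n) in
/-- The ring homomorphism `X_t ↦ (w_t)_⟨j⟩ X_t`. -/
noncomputable def substAt (w : τ → Fin m → ℕ) (j : Fin n) :
    MvPolynomial τ ℤ →+* MvPolynomial τ (CoordRing K m n) :=
  eval₂Hom (Int.castRingHom _) fun t => C (monomialAt K m n (w t) j) * X t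

theorem substAt_monomial (w : τ → Fin m → ℕ) (j : Fin n) (ν : τ →₀ ℕ) (c : ℤ) :
    substAt K n w j (monomial ν c) = monomial ν ((c : CoordRing K m n) *
      monomialAt K m n (weight w ν) j) := by
  classical
  have h : ∀ ν : τ →₀ ℕ, (ν.prod fun t k => (C (monomialAt K m n (w t) j) * X t) ^ k) =
      monomial ν (monomialAt K m n (weight w ν) j) := by
    intro ν
    induction ν using Finsupp.induction_linear with
    | zero => simp [weight_zero, monomialAt_zero]
    | add f g hf hg =>
      rw [Finsupp.prod_add_index' (fun _ => pow_zero _) (fun _ _ _ => pow_add _ _ _), hf, hg,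
        weight_add, monomialAt_add, monomial_mul]
    | single t k =>
      rw [Finsupp.prod_single_index (by exact pow_zero _), weight_single, monomialAt_smul, mul_pow,
        ← C_pow, C_mul_X_pow_eq_monomial]
  rw [substAt, coe_eval₂Hom, eval₂_monomial, h, eq_intCast,
    ← map_intCast (C (σ := τ) (R := CoordRing K m n)), C_mul_monomial]

theorem coeff_substAt (w : τ → Fin m → ℕ) (j : Fin n) (P : MvPolynomial τ ℤ) (ν : τ →₀ ℕ) :
    coeff ν (substAt K n w j P) =
      ((coeff ν P : ℤ) : CoordRing K m n) * monomialAt K m n (weight w ν) j := by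
  classical
  induction P using MvPolynomial.induction_on' with
  | monomial κ c =>
    rw [substAt_monomial, coeff_monomial, coeff_monomial]
    split_ifs with h
    · rw [h]
    · simp
  | add p q hp hq => rw [map_add, coeff_add, hp, hq, coeff_add]; push_cast; ring

variable (K n) in
/-- The norm `∏_j P((w_t)_⟨j⟩ X_t)`. -/
noncomputable def norm (w : τ → Fin m → ℕ) :
    MvPolynomial τ ℤ →* MvPolynomial τ (CoordRing K m n) where
  toFun P := ∏ j : Fin n, substAt K n w j P
  map_one' := by simp
  map_mul' P Q := by simp [Finset.prod_mul_distrib]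

theorem norm_apply (w : τ → Fin m → ℕ) (P : MvPolynomial τ ℤ) :
    norm K n w P = ∏ j : Fin n, substAt K n w j P := rfl

theorem norm_one_add_monomial (w : τ → Fin m → ℕ) (ν : τ →₀ ℕ) (c : ℤ) :
    norm K n w (1 + monomial ν c) = ∑ r ∈ Finset.range (n + 1),
      monomial (r • ν) ((c : CoordRing K m n) ^ r * sigma K m n r (weight w ν)) := by
  classical
  simp only [norm_apply, map_add, map_one, substAt_monomial]
  rw [Finset.prod_one_add, Finset.sum_powerset, Finset.card_univ, Fintype.card_fin]
  refine Finset.sum_congr rfl fun r _ => ?_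
  rw [sigma, Finset.mul_sum, map_sum]
  refine Finset.sum_congr rfl fun s hs => ?_
  rw [Finset.mem_powersetCard] at hs
  rw [← monomial_sum_prod]
  simp [Finset.prod_mul_distrib, hs.2, Finset.sum_const]

/-- Each substitution only rescales coefficients, so it preserves congruences modulo order D, and so
does the product over j. -/
theorem norm_sub_mem (w : τ → Fin m → ℕ) {P Q : MvPolynomial τ ℤ} {D : ℕ}
    (h : P - Q ∈ idealOfVars τ ℤ ^ D) :
    norm K n w P - norm K n w Q ∈ idealOfVars τ (CoordRing K m n) ^ D := by
  rw [← Ideal.Quotient.eq, norm_apply, norm_apply, map_prod, map_prod]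
  refine Finset.prod_congr rfl fun j _ => ?_
  rw [Ideal.Quotient.eq, ← map_sub, mem_pow_idealOfVars_iff']
  intro x hx
  rw [coeff_substAt, (mem_pow_idealOfVars_iff' _ _).1 h x hx]
  simp

end Norm

/-! ### Filtration by degree; norms modulo lower degree -/

section Filtration

variable (K : Type*) [CommRing K] (m n : ℕ)

/-- The subalgebra generated by the `σ_r(w)` of degree less than `d`. -/
noncomputable def sigmaBelow (d : ℕ) : Subalgebra K (CoordRing K m n) :=
  Algebra.adjoin K {f | ∃ (r : ℕ) (α : Fin m → ℕ), r * ∑ i, α i < d ∧ f = sigma K m n r α}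

variable {K m n}

theorem sigma_mem_sigmaBelow {r d : ℕ} {α : Fin m → ℕ} (h : r * ∑ i, α i < d) :
    sigma K m n r α ∈ sigmaBelow K m n d :=
  Algebra.subset_adjoin ⟨r, α, h, rfl⟩

theorem sigmaBelow_mono {d e : ℕ} (h : d ≤ e) : sigmaBelow K m n d ≤ sigmaBelow K m n e :=
  Algebra.adjoin_mono fun _ ⟨r, α, hr, hf⟩ => ⟨r, α, hr.trans_le h, hf⟩

theorem sigma_eq_zero {r : ℕ} (hr : n < r) (α : Fin m → ℕ) : sigma K m n r α = 0 := by
  rw [sigma, Finset.powersetCard_eq_empty.2 (by simpa using hr), Finset.sum_empty]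

variable (K n) in
/-- The ring homomorphism `x_j ↦ w_⟨j⟩`. -/
noncomputable def specialize (α : Fin m → ℕ) : MvPolynomial (Fin n) ℤ →+* CoordRing K m n :=
  eval₂Hom (Int.castRingHom _) (monomialAt K m n α)

theorem specialize_expand_esymm (α : Fin m → ℕ) (h r : ℕ) :
    specialize K n α (expand h (esymm (Fin n) ℤ r)) = sigma K m n r (h • α) := by
  simp [esymm, sigma, specialize, monomialAt_smul, -nsmul_eq_mul, -smul_eq_mul]

theorem specialize_esymm (α : Fin m → ℕ) (r : ℕ) :
    specialize K n α (esymm (Fin n) ℤ r) = sigma K m n r α := by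
  simp [esymm, sigma, specialize]

theorem sum_pos_of_ne_zero {α : Fin m → ℕ} (hα : α ≠ 0) : 0 < ∑ i, α i := by
  obtain ⟨i, hi⟩ := Function.ne_iff.1 hα
  exact Finset.sum_pos' (fun _ _ => Nat.zero_le _) ⟨i, Finset.mem_univ _, Nat.pos_of_ne_zero hi⟩

theorem sum_smul (k : ℕ) (α : Fin m → ℕ) : ∑ i, (k • α) i = k * ∑ i, α i := by
  simp [Finset.mul_sum]

theorem specialize_mem_sigmaBelow {α : Fin m → ℕ} (hα : α ≠ 0) {d : ℕ}
    {f : MvPolynomial (Fin n) ℤ} (hf : f ∈ esymmBelow n d) :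
    specialize K n α f ∈ sigmaBelow K m n (d * ∑ i, α i) := by
  induction hf using Algebra.adjoin_induction with
  | mem f hf =>
    obtain ⟨i, hi, rfl⟩ := hf
    rw [specialize_esymm]
    exact sigma_mem_sigmaBelow (Nat.mul_lt_mul_of_pos_right hi (sum_pos_of_ne_zero hα))
  | algebraMap c => simp
  | add f g _ _ hf hg => rw [map_add]; exact add_mem hf hg
  | mul f g _ _ hf hg => rw [map_mul]; exact mul_mem hf hg

/-- The substitution x_j ↦ w_⟨j⟩ carries the one-vector congruence over ℤ to K[V^m]. -/
theorem sigma_smul_sub_mem {α : Fin m → ℕ} (hα : α ≠ 0) {h r : ℕ} (hh : 0 < h) (hr : 0 < r) :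
    sigma K m n r (h • α) -
      (-1) ^ (h * r + r) * (h : CoordRing K m n) * sigma K m n (h * r) α ∈
      sigmaBelow K m n (h * r * ∑ i, α i) := by
  have := specialize_mem_sigmaBelow (K := K) hα (expand_esymm_sub_mem_esymmBelow (n := n) h r hh hr)
  simpa only [map_sub, map_mul, map_pow, map_neg, map_one, map_natCast, specialize_esymm,
    specialize_expand_esymm] using this

variable {τ : Type*}

theorem coeff_zero_norm (w : τ → Fin m → ℕ) {P : MvPolynomial τ ℤ} (hP : coeff 0 P = 1) :
    coeff 0 (norm K n w P) = 1 := by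
  rw [norm_apply, ← constantCoeff_eq, map_prod]
  refine Finset.prod_eq_one fun j _ => ?_
  rw [constantCoeff_eq, coeff_substAt, hP, weight_zero, monomialAt_zero]
  simp

theorem coeff_zero_of_mem_binomialProducts {P : MvPolynomial τ ℤ} (hP : P ∈ binomialProducts τ) :
    coeff 0 P = 1 := by
  classical
  induction hP using Submonoid.closure_induction with
  | mem f hf =>
    obtain ⟨ν, c, hν, rfl⟩ := hf
    simp [coeff_monomial, hν]
  | one => simp
  | mul f g _ _ hf hg => rw [← constantCoeff_eq] at *; rw [map_mul, hf, hg, mul_one]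

theorem coeff_norm_one_add_monomial (w : τ → Fin m → ℕ) {ν : τ →₀ ℕ} (hν : ν ≠ 0) (c : ℤ) (r : ℕ) :
    coeff (r • ν) (norm K n w (1 + monomial ν c)) =
      (c : CoordRing K m n) ^ r * sigma K m n r (weight w ν) := by
  classical
  rw [norm_one_add_monomial, coeff_sum]
  have hinj : ∀ x, x • ν = r • ν ↔ x = r := fun x => by
    obtain ⟨t, ht⟩ := Finsupp.ne_iff.1 hν
    refine ⟨fun h => ?_, fun h => by rw [h]⟩
    have := DFunLike.congr_fun h t
    simpa [show ν t ≠ 0 from ht] using this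
  simp only [coeff_monomial, hinj]
  rw [Finset.sum_ite_eq']
  split_ifs with h
  · rfl
  · rw [sigma_eq_zero (by simpa using h), mul_zero]

theorem coeff_norm_one_add_monomial_of_forall_ne (w : τ → Fin m → ℕ) {ν : τ →₀ ℕ} (c : ℤ)
    {μ : τ →₀ ℕ} (hμ : ∀ r : ℕ, r • ν ≠ μ) :
    coeff μ (norm K n w (1 + monomial ν c)) = 0 := by
  classical
  rw [norm_one_add_monomial, coeff_sum]
  simp [coeff_monomial, hμ]

theorem coeff_norm_mem_of_mem_binomialProducts (w : τ → Fin m → ℕ) {P : MvPolynomial τ ℤ}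
    (hP : P ∈ binomialProducts τ) (μ : τ →₀ ℕ) :
    coeff μ (norm K n w P) ∈ sigmaBelow K m n (∑ i, weight w μ i + 1) := by
  classical
  induction hP using Submonoid.closure_induction generalizing μ with
  | mem f hf =>
    obtain ⟨ν, c, hν, rfl⟩ := hf
    by_cases h : ∃ r : ℕ, r • ν = μ
    · obtain ⟨r, rfl⟩ := h
      rw [coeff_norm_one_add_monomial w hν]
      refine mul_mem (pow_mem (intCast_mem _ _) _) (sigma_mem_sigmaBelow ?_)
      rw [weight_smul, sum_smul]
      exact Nat.lt_succ_self _
    · rw [coeff_norm_one_add_monomial_of_forall_ne w c (not_exists.1 h)]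
      exact zero_mem _
  | one =>
    rw [map_one, coeff_one]
    split_ifs
    · exact one_mem _
    · exact zero_mem _
  | mul f g _ _ hf hg =>
    rw [map_mul, coeff_mul]
    refine sum_mem fun a ha => ?_
    rw [Finset.HasAntidiagonal.mem_antidiagonal] at ha
    have hs : ∑ i, weight w μ i = ∑ i, weight w a.1 i + ∑ i, weight w a.2 i := by
      rw [← ha, weight_add, ← Finset.sum_add_distrib]; rfl
    exact mul_mem (sigmaBelow_mono (by omega) (hf a.1)) (sigmaBelow_mono (by omega) (hg a.2))

/-- The coefficient at μ depends on P only up to degree |μ|, so P may be replaced by a product of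
binomials. -/
theorem coeff_norm_mem (w : τ → Fin m → ℕ) {P : MvPolynomial τ ℤ} (hP : coeff 0 P = 1)
    (μ : τ →₀ ℕ) :
    coeff μ (norm K n w P) ∈ sigmaBelow K m n (∑ i, weight w μ i + 1) := by
  obtain ⟨Q, hQ, hPQ⟩ := exists_binomialProduct P hP μ.degree
  have h := (mem_pow_idealOfVars_iff' _ _).1 (norm_sub_mem (K := K) (n := n) w hPQ) μ
    (Nat.lt_succ_self _)
  rw [coeff_sub, sub_eq_zero] at h
  rw [h]
  exact coeff_norm_mem_of_mem_binomialProducts w hQ μ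

theorem weight_sum_pos {w : τ → Fin m → ℕ} (hw : ∀ t, w t ≠ 0) {ν : τ →₀ ℕ} (hν : ν ≠ 0) :
    0 < ∑ i, weight w ν i := by
  obtain ⟨t, ht⟩ := Finsupp.ne_iff.1 hν
  have h : ν = Finsupp.single t 1 + (ν - Finsupp.single t 1) := by
    rw [add_tsub_cancel_of_le]
    rw [Finsupp.single_le_iff]
    exact Nat.pos_of_ne_zero ht
  have h1 := sum_pos_of_ne_zero (hw t)
  rw [h, weight_add, weight_single, one_smul]
  simp only [Pi.add_apply, Finset.sum_add_distrib]
  omega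

/-- The norm is additive modulo products of elements of lower degree. -/
theorem coeff_norm_mul_sub_mem {w : τ → Fin m → ℕ} (hw : ∀ t, w t ≠ 0) {P Q : MvPolynomial τ ℤ}
    (hP : coeff 0 P = 1) (hQ : coeff 0 Q = 1) {μ : τ →₀ ℕ} (hμ : μ ≠ 0) :
    coeff μ (norm K n w (P * Q)) - coeff μ (norm K n w P) - coeff μ (norm K n w Q) ∈
      sigmaBelow K m n (∑ i, weight w μ i) := by
  classical
  -- Both factors on the right have constant term 0, so only splittings of μ into two nonzero parts
  -- contribute, each of lower weight.
  have h : coeff μ (norm K n w (P * Q)) - coeff μ (norm K n w P) - coeff μ (norm K n w Q) =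
      coeff μ ((norm K n w P - 1) * (norm K n w Q - 1)) := by
    have : (norm K n w P - 1) * (norm K n w Q - 1) =
        norm K n w (P * Q) - norm K n w P - norm K n w Q + 1 := by rw [map_mul]; ring
    rw [this, coeff_add, coeff_sub, coeff_sub, coeff_one, if_neg hμ.symm, add_zero]
  rw [h, coeff_mul]
  refine sum_mem fun a ha => ?_
  rw [Finset.HasAntidiagonal.mem_antidiagonal] at ha
  by_cases h1 : a.1 = 0
  · rw [h1, coeff_sub, coeff_zero_norm w hP]; simp
  by_cases h2 : a.2 = 0
  · rw [h2, coeff_sub _ 0, coeff_zero_norm w hQ]; simp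
  have hs : ∑ i, weight w μ i = ∑ i, weight w a.1 i + ∑ i, weight w a.2 i := by
    rw [← ha, weight_add, ← Finset.sum_add_distrib]; rfl
  have p1 := weight_sum_pos hw h1
  have p2 := weight_sum_pos hw h2
  rw [coeff_sub, coeff_sub, coeff_one, coeff_one, if_neg (Ne.symm h1), if_neg (Ne.symm h2),
    sub_zero, sub_zero]
  exact mul_mem (sigmaBelow_mono (by omega) (coeff_norm_mem w hP a.1))
    (sigmaBelow_mono (by omega) (coeff_norm_mem w hQ a.2))

end Filtration

/-! ### Logarithmic derivative via dual numbers -/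

section LogDerivative

/-- The ring homomorphism `X_0 ↦ X`, `X_1 ↦ X ε` into dual numbers over power series. -/
noncomputable def toDual : MvPolynomial (Fin 2) ℤ →+* DualNumber (PowerSeries ℤ) :=
  eval₂Hom (Int.castRingHom _)
    ![TrivSqZeroExt.inl PowerSeries.X, TrivSqZeroExt.inr PowerSeries.X]

theorem toDual_X_zero : toDual (X 0) = TrivSqZeroExt.inl PowerSeries.X := by simp [toDual]

theorem toDual_X_one : toDual (X 1) = TrivSqZeroExt.inr PowerSeries.X := by simp [toDual]

theorem inr_pow_add_two {R : Type*} [CommRing R] (x : R) (k : ℕ) :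
    (TrivSqZeroExt.inr x : DualNumber R) ^ (k + 2) = 0 := by
  rw [pow_add, pow_two, TrivSqZeroExt.inr_mul_inr, mul_zero]

theorem toDual_monomial (ν : Fin 2 →₀ ℕ) (c : ℤ) :
    toDual (monomial ν c) = (c : DualNumber (PowerSeries ℤ)) *
      (TrivSqZeroExt.inl PowerSeries.X ^ ν 0 * TrivSqZeroExt.inr PowerSeries.X ^ ν 1) := by
  rw [toDual, coe_eval₂Hom, eval₂_monomial, Finsupp.prod_fintype _ _ (fun _ => pow_zero _)]
  simp

/-- The image X ε of X_1 keeps a factor X, so order in total degree becomes X-adic order. -/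
theorem toDual_mem {P : MvPolynomial (Fin 2) ℤ} {D : ℕ} (hP : P ∈ idealOfVars (Fin 2) ℤ ^ D) :
    ∃ a b, (toDual P).fst = PowerSeries.X ^ D * a ∧ (toDual P).snd = PowerSeries.X ^ D * b := by
  have h : toDual P ∈ Ideal.span {(TrivSqZeroExt.inl PowerSeries.X :
      DualNumber (PowerSeries ℤ))} ^ D := by
    have h1 : (idealOfVars (Fin 2) ℤ).map toDual ≤
        Ideal.span {(TrivSqZeroExt.inl PowerSeries.X : DualNumber (PowerSeries ℤ))} := by
      rw [idealOfVars, Ideal.map_span, Ideal.span_le]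
      rintro _ ⟨_, ⟨i, rfl⟩, rfl⟩
      rw [SetLike.mem_coe, Ideal.mem_span_singleton]
      fin_cases i
      · exact (dvd_of_eq toDual_X_zero.symm)
      · refine ⟨TrivSqZeroExt.inr 1, ?_⟩
        rw [TrivSqZeroExt.inl_mul_inr]
        simpa using toDual_X_one
    refine Ideal.pow_right_mono h1 D ?_
    rw [← Ideal.map_pow]
    exact Ideal.mem_map_of_mem _ hP
  rw [Ideal.span_singleton_pow, Ideal.mem_span_singleton] at h
  obtain ⟨z, hz⟩ := h
  exact ⟨z.fst, z.snd, by rw [hz]; simp, by rw [hz]; simp⟩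

/-- The logarithmic derivative of a binomial, with respect to `ε`. -/
theorem exists_toDual_one_add_monomial (ν : Fin 2 →₀ ℕ) (c : ℤ) :
    ∃ L, (toDual (1 + monomial ν c)).snd = (toDual (1 + monomial ν c)).fst * L ∧
      ∀ k, PowerSeries.coeff (k + 1) L = if ν 0 = k ∧ ν 1 = 1 then c else 0 := by
  have hc : (c : DualNumber (PowerSeries ℤ)) = TrivSqZeroExt.inl (c : PowerSeries ℤ) := by simp
  rw [map_add, map_one, toDual_monomial, hc]
  rcases h : ν 1 with _ | _ | j
  · exact ⟨0, by simp, by simp⟩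
  · refine ⟨(c : PowerSeries ℤ) * PowerSeries.X ^ (ν 0 + 1), ?_, fun k => ?_⟩
    · simp [pow_succ]
      ring
    · rw [← map_intCast (PowerSeries.C (R := ℤ)), PowerSeries.coeff_C_mul,
        PowerSeries.coeff_X_pow]
      simp [eq_comm]
  · refine ⟨0, ?_, by simp⟩
    rw [inr_pow_add_two]
    simp

/-- The image of 1 - X_0 + X_1 is 1 - X + X ε, with logarithmic derivative X/(1 - X), all of whose
coefficients in positive degree are 1. The error of order D does not reach degree k + 1. -/
theorem coeff_of_toDual_sub_mem {Q : MvPolynomial (Fin 2) ℤ} {D k : ℕ} (hk : k + 1 < D)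
    (hQ : (1 - X 0 + X 1) - Q ∈ idealOfVars (Fin 2) ℤ ^ D) {L : PowerSeries ℤ}
    (hL : (toDual Q).snd = (toDual Q).fst * L) : PowerSeries.coeff (k + 1) L = 1 := by
  obtain ⟨a, b, ha, hb⟩ := toDual_mem hQ
  rw [map_sub, map_add, map_sub, map_one, toDual_X_zero, toDual_X_one] at ha hb
  simp only [TrivSqZeroExt.fst_sub, TrivSqZeroExt.fst_add, TrivSqZeroExt.fst_one,
    TrivSqZeroExt.fst_inl, TrivSqZeroExt.fst_inr, TrivSqZeroExt.snd_sub, TrivSqZeroExt.snd_add,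
    TrivSqZeroExt.snd_one, TrivSqZeroExt.snd_inl, TrivSqZeroExt.snd_inr] at ha hb
  have hG := PowerSeries.mk_one_mul_one_sub_eq_one ℤ
  have h : L = PowerSeries.X * PowerSeries.mk 1 +
      PowerSeries.X ^ D * (PowerSeries.mk 1 * (a * L - b)) := by
    linear_combination (-L) * hG - PowerSeries.mk 1 * (hL + hb - L * ha)
  rw [h, map_add, PowerSeries.coeff_succ_X_mul, PowerSeries.coeff_X_pow_mul', if_neg (by omega)]
  simp

end LogDerivative

/-! ### Decomposability of σ_g(w) of large degree in one vector -/

section Decomposition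

variable {K : Type*} [CommRing K] {m n : ℕ}

/-- A coefficient of the norm of a product of binomials is an integral multiple of `σ_g(w)` modulo
elements of lower degree, and the multiple is determined modulo `p` by a logarithmic derivative. -/
theorem exists_coeff_norm_sub_mem {α : Fin m → ℕ} (hα : α ≠ 0) {p : ℕ} [Fact p.Prime] {s g' k : ℕ}
    (hg' : 0 < g') {w : Fin 2 → Fin m → ℕ} (hw : ∀ t, w t ≠ 0) {ν₀ : Fin 2 →₀ ℕ} (h₀ : ν₀ 0 = k)
    (h₁ : ν₀ 1 = 1) (hν₀ : weight w ν₀ = g' • α) {Q : MvPolynomial (Fin 2) ℤ}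
    (hQ : Q ∈ binomialProducts (Fin 2)) :
    ∃ N : ℤ, coeff (p ^ s • ν₀) (norm K n w Q) -
        (N : CoordRing K m n) * sigma K m n (p ^ s * g') α ∈
        sigmaBelow K m n (p ^ s * g' * ∑ i, α i) ∧
      ∃ L, (toDual Q).snd = (toDual Q).fst * L ∧
        (N : ZMod p) = (-1) ^ (p ^ s * g' + p ^ s) * (g' : ZMod p) *
          ((PowerSeries.coeff (k + 1) L : ℤ) : ZMod p) := by
  have hp : p.Prime := Fact.out
  have hq : 0 < p ^ s := pow_pos hp.pos s
  have hμ : p ^ s • ν₀ ≠ 0 := by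
    intro h
    have := DFunLike.congr_fun h 1
    simp [h₁, hp.ne_zero] at this
  have hwt : ∑ i, weight w (p ^ s • ν₀) i = p ^ s * g' * ∑ i, α i := by
    rw [weight_smul, hν₀, sum_smul, sum_smul, mul_assoc]
  induction hQ using Submonoid.closure_induction with
  | one =>
    refine ⟨0, ?_, 0, by simp, by simp⟩
    classical
    rw [map_one, coeff_one, if_neg hμ.symm]
    simp
  | mul P R hP hR ihP ihR =>
    obtain ⟨N₁, hN₁, L₁, hL₁, hc₁⟩ := ihP
    obtain ⟨N₂, hN₂, L₂, hL₂, hc₂⟩ := ihR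
    refine ⟨N₁ + N₂, ?_, L₁ + L₂, ?_, ?_⟩
    · have h := coeff_norm_mul_sub_mem (K := K) (n := n) hw
        (coeff_zero_of_mem_binomialProducts hP) (coeff_zero_of_mem_binomialProducts hR) hμ
      rw [hwt] at h
      have := add_mem (add_mem h hN₁) hN₂
      push_cast
      convert this using 1
      ring
    · rw [map_mul, TrivSqZeroExt.fst_mul, TrivSqZeroExt.snd_mul, hL₁, hL₂]
      simp only [smul_eq_mul, MulOpposite.smul_eq_mul_unop, MulOpposite.unop_op]
      ring
    · push_cast [map_add]
      rw [hc₁, hc₂]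
      ring
  | mem f hf =>
    obtain ⟨ν, c, hν, rfl⟩ := hf
    obtain ⟨L, hL, hcL⟩ := exists_toDual_one_add_monomial ν c
    by_cases h : ∃ r : ℕ, r • ν = p ^ s • ν₀
    · obtain ⟨r, hr⟩ := h
      have hr0 : r * ν 0 = p ^ s * k := by simpa [h₀] using DFunLike.congr_fun hr 0
      have hr1 : r * ν 1 = p ^ s := by simpa [h₁] using DFunLike.congr_fun hr 1
      have hrpos : 0 < r := Nat.pos_of_mul_pos_right (hr1 ▸ hq)
      have hνpos : 0 < ν 1 := Nat.pos_of_mul_pos_left (hr1 ▸ hq)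
      have hwν : weight w ν = (ν 1 * g') • α := by
        have h2 : r • weight w ν = r • ((ν 1 * g') • α) := by
          rw [← weight_smul, hr, weight_smul, hν₀, smul_smul, smul_smul, ← mul_assoc, hr1]
        funext i
        have := congrFun h2 i
        simpa [hrpos.ne'] using this
      have hdeg : ν 1 * g' * r = p ^ s * g' := by rw [← hr1]; ring
      refine ⟨c ^ r * ((-1) ^ (p ^ s * g' + r) * (ν 1 * g' : ℕ)), ?_, L, hL, ?_⟩
      · rw [← hr, coeff_norm_one_add_monomial w hν, hwν]
        have h3 := sigma_smul_sub_mem (K := K) (n := n) hα (Nat.mul_pos hνpos hg') hrpos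
        rw [hdeg] at h3
        have h4 := mul_mem (pow_mem (intCast_mem (sigmaBelow K m n (p ^ s * g' * ∑ i, α i)) c) r) h3
        convert h4 using 1
        push_cast
        ring
      · rw [hcL]
        -- Since r · ν 1 = p^s, either ν = ν₀ and c^(p^s) = c in `ZMod p`, or p divides ν 1 and the
        -- contribution vanishes modulo p.
        by_cases hν1 : ν 1 = 1
        · have hrq : r = p ^ s := by rw [← hr1, hν1, mul_one]
          have hνk : ν 0 = k := by
            rw [hrq] at hr0
            exact Nat.eq_of_mul_eq_mul_left hq hr0
          rw [if_pos ⟨hνk, hν1⟩, hν1, hrq]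
          push_cast
          rw [ZMod.pow_card_pow]
          ring
        · rw [if_neg fun h => hν1 h.2]
          have hdvd : p ∣ ν 1 := by
            obtain ⟨j, -, hj⟩ := (Nat.dvd_prime_pow hp).1 (Dvd.intro_left r hr1)
            rw [hj]
            refine dvd_pow_self p ?_
            rintro rfl
            exact hν1 (by simpa using hj)
          have h5 : ((ν 1 : ℕ) : ZMod p) = 0 := (ZMod.natCast_eq_zero_iff _ _).2 hdvd
          push_cast
          rw [h5]
          ring
    · refine ⟨0, ?_, L, hL, ?_⟩
      · rw [coeff_norm_one_add_monomial_of_forall_ne w c (not_exists.1 h)]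
        simp
      · rw [hcL, if_neg]
        · simp
        · rintro ⟨h0, h1⟩
          refine h ⟨p ^ s, congrArg _ (Finsupp.ext fun t => ?_)⟩
          fin_cases t
          · exact h0.trans h₀.symm
          · exact h1.trans h₁.symm

/-- The norm is a product of n factors of degree at most 1. -/
theorem coeff_norm_eq_zero_of_lt_degree (w : Fin 2 → Fin m → ℕ) {μ : Fin 2 →₀ ℕ}
    (hμ : n < μ.degree) : coeff μ (norm K n w (1 - X 0 + X 1)) = 0 := by
  refine coeff_eq_zero_of_totalDegree_lt (lt_of_le_of_lt ?_ hμ)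
  rw [norm_apply]
  refine (totalDegree_finsetProd _ _).trans ?_
  refine (Finset.sum_le_card_nsmul _ _ 1 fun j _ => ?_).trans (by simp)
  have hX : ∀ t, (substAt K n w j (X t)).totalDegree ≤ 1 := fun t => by
    rw [X, substAt_monomial]
    exact (totalDegree_monomial_le _ _).trans (by simp)
  rw [map_add, map_sub, map_one]
  refine (totalDegree_add _ _).trans (max_le ((totalDegree_sub _ _).trans (max_le ?_ (hX 0))) (hX 1))
  simp

theorem exists_mul_sigma_mem {α : Fin m → ℕ} {i i' : Fin m} (hi : i' ≠ i) (hα : α i' ≠ 0) {g : ℕ}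
    (hg : 0 < g) (hn : n ≤ g * α i) {p : ℕ} (hp : p.Prime) :
    ∃ N : ℤ, ¬ (p : ℤ) ∣ N ∧
      (N : CoordRing K m n) * sigma K m n g α ∈ sigmaBelow K m n (g * ∑ i, α i) := by
  have : Fact p.Prime := ⟨hp⟩
  obtain ⟨s, g', hpg', rfl⟩ := Nat.exists_eq_pow_mul_and_not_dvd hg.ne' p hp.ne_one
  have hg' : 0 < g' := Nat.pos_of_ne_zero fun h => hpg' (h ▸ dvd_zero p)
  have hq : 0 < p ^ s := pow_pos hp.pos s
  have hα0 : α ≠ 0 := fun h => hα (by rw [h]; rfl)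
  set w : Fin 2 → Fin m → ℕ := ![Pi.single i 1, g' • Function.update α i 0] with hwdef
  have hw : ∀ t, w t ≠ 0 := by
    intro t ht
    fin_cases t
    · have := congrFun ht i
      simp [w] at this
    · have := congrFun ht i'
      simp [w, Function.update_of_ne hi, hα, hg'.ne'] at this
  -- Chosen so that w^ν₀ has exponent g' α, while p^s ν₀ has degree p^s g' α_i + p^s > n.
  set ν₀ : Fin 2 →₀ ℕ := Finsupp.single 0 (g' * α i) + Finsupp.single 1 1 with hνdef
  have h₀ : ν₀ 0 = g' * α i := by simp [ν₀]
  have h₁ : ν₀ 1 = 1 := by simp [ν₀]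
  have hν₀ : weight w ν₀ = g' • α := by
    rw [hνdef, weight_add, weight_single, weight_single]
    funext l
    by_cases hl : l = i
    · subst hl; simp [w]
    · simp [w, hl]
  have hdeg : (p ^ s • ν₀).degree = p ^ s * (g' * α i) + p ^ s := by
    rw [map_nsmul, hνdef, map_add, Finsupp.degree_single, Finsupp.degree_single, smul_eq_mul]
    ring
  have hP : coeff 0 (1 - X 0 + X 1 : MvPolynomial (Fin 2) ℤ) = 1 := by
    rw [← constantCoeff_eq]; simp
  obtain ⟨Q, hQ, hPQ⟩ := exists_binomialProduct _ hP (p ^ s • ν₀).degree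
  obtain ⟨N, hN, L, hL, hNL⟩ := exists_coeff_norm_sub_mem (K := K) (n := n) hα0 (p := p) (s := s)
    hg' hw h₀ h₁ hν₀ hQ
  have h := (mem_pow_idealOfVars_iff' _ _).1 (norm_sub_mem (K := K) (n := n) w hPQ) (p ^ s • ν₀)
    (Nat.lt_succ_self _)
  rw [coeff_sub, coeff_norm_eq_zero_of_lt_degree w (by rw [hdeg, ← mul_assoc]; omega), zero_sub,
    neg_eq_zero] at h
  rw [h, zero_sub, neg_mem_iff] at hN
  refine ⟨N, fun hdvd => ?_, hN⟩
  have hk : g' * α i + 1 < (p ^ s • ν₀).degree + 1 := by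
    have : g' * α i ≤ p ^ s * (g' * α i) := Nat.le_mul_of_pos_left _ hq
    omega
  rw [coeff_of_toDual_sub_mem hk hPQ hL, (ZMod.intCast_zmod_eq_zero_iff_dvd _ _).2 hdvd] at hNL
  have h0 : (g' : ZMod p) ≠ 0 := by rwa [Ne, ZMod.natCast_eq_zero_iff]
  have h1 : ((-1 : ZMod p) ^ (p ^ s * g' + p ^ s)) ≠ 0 := pow_ne_zero _ (neg_ne_zero.2 one_ne_zero)
  simp only [Int.cast_one, mul_one] at hNL
  exact mul_ne_zero h1 h0 hNL.symm

/-- `σ_g(w)` is a polynomial in the `σ_r(v)` of lower degree if its degree in one of the vectors is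
at least `n` and `w` involves another vector. -/
theorem sigma_mem_sigmaBelow_of_le {α : Fin m → ℕ} {i i' : Fin m} (hi : i' ≠ i) (hα : α i' ≠ 0)
    {g : ℕ} (hg : 0 < g) (hn : n ≤ g * α i) :
    sigma K m n g α ∈ sigmaBelow K m n (g * ∑ i, α i) := by
  -- The multipliers making σ_g(w) decomposable form an ideal of ℤ lying in no (p), hence equal to
  -- ℤ.
  let I : Ideal ℤ :=
    { carrier := {N | (N : CoordRing K m n) * sigma K m n g α ∈ sigmaBelow K m n (g * ∑ i, α i)}
      zero_mem' := by simp
      add_mem' := fun {a b} ha hb => by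
        simp only [Set.mem_ofPred_eq] at *
        push_cast
        rw [add_mul]
        exact add_mem ha hb
      smul_mem' := fun c a ha => by
        simp only [Set.mem_ofPred_eq, smul_eq_mul] at *
        push_cast
        rw [mul_assoc]
        exact mul_mem (intCast_mem _ _) ha }
  have hI : (1 : ℤ) ∈ I := by
    rw [← Ideal.eq_top_iff_one, ← Ideal.span_singleton_generator I,
      Ideal.span_singleton_eq_top, Int.isUnit_iff_natAbs_eq]
    by_contra h
    obtain ⟨p, hp, hpd⟩ := Nat.exists_prime_and_dvd h
    obtain ⟨N, hN, hmem⟩ := exists_mul_sigma_mem (K := K) hi hα hg hn hp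
    have hNI : N ∈ I := hmem
    rw [← Ideal.span_singleton_generator I, Ideal.mem_span_singleton] at hNI
    exact hN ((Int.natCast_dvd.2 hpd).trans hNI)
  have : ((1 : ℤ) : CoordRing K m n) * sigma K m n g α ∈ sigmaBelow K m n (g * ∑ i, α i) := hI
  simpa using this

end Decomposition

/-! ### Orbit sums and generation of the invariants -/

section Generation

variable {K : Type*} [CommRing K] {m n : ℕ}

/-- The exponent of the monomial `∏_j x_j^{e_j}`. -/
noncomputable def rowsExponent : (Fin n → Fin m → ℕ) ≃ (Fin m × Fin n →₀ ℕ) :=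
  ((Equiv.piComm _).trans (Equiv.curry _ _ _).symm).trans Finsupp.equivFunOnFinite.symm

theorem rowsExponent_apply (e : Fin n → Fin m → ℕ) (x : Fin m × Fin n) :
    rowsExponent e x = e x.2 x.1 := rfl

theorem prod_monomialAt (e : Fin n → Fin m → ℕ) :
    ∏ j, monomialAt K m n (e j) j = monomial (rowsExponent e) 1 := by
  rw [monomial_eq, C_1, one_mul, Finsupp.prod_fintype _ _ (fun _ => pow_zero _),
    Fintype.prod_prod_type_right]
  rfl

theorem coeff_rowsExponent_comp {f : CoordRing K m n} (hf : f ∈ invariants K m n)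
    (e : Fin n → Fin m → ℕ) (π : Equiv.Perm (Fin n)) :
    coeff (rowsExponent (e ∘ π)) f = coeff (rowsExponent e) f := by
  have hinj : Function.Injective fun p : Fin m × Fin n => (p.1, π p.2) := fun p q h => by
    simpa [Prod.ext_iff] using h
  have hmap : (rowsExponent (e ∘ π)).mapDomain (fun p : Fin m × Fin n => (p.1, π p.2)) =
      rowsExponent e := by
    ext ⟨i, j⟩
    have := Finsupp.mapDomain_apply hinj (rowsExponent (e ∘ π)) (i, π.symm j)
    simpa [rowsExponent_apply] using this
  rw [← coeff_rename_mapDomain _ hinj f, hmap]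
  exact congrArg (coeff (rowsExponent e)) (hf π)

/-- The multiplicities of the nonzero rows of `e`. -/
noncomputable def rowType (e : Fin n → Fin m → ℕ) : (Fin m → ℕ) →₀ ℕ :=
  ∑ j, if e j = 0 then 0 else Finsupp.single (e j) 1

/-- The number of zero rows, which `rowType` omits, is n minus its degree, so all fibres of e and e'
have equal size. -/
theorem exists_perm_of_rowType_eq {e e' : Fin n → Fin m → ℕ} (h : rowType e = rowType e') :
    ∃ π : Equiv.Perm (Fin n), e' ∘ π = e := by
  have h0 : ∀ e : Fin n → Fin m → ℕ,
      Fintype.card {j // e j = 0} + (rowType e).degree = n := by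
    intro e
    rw [rowType, map_sum, Fintype.card_subtype, Finset.card_filter, ← Finset.sum_add_distrib]
    rw [Finset.sum_congr rfl (g := fun _ => 1)]
    · simp
    · intro j _
      split_ifs <;> simp
  have h1 : ∀ (e : Fin n → Fin m → ℕ) (a : Fin m → ℕ), a ≠ 0 →
      Fintype.card {j // e j = a} = rowType e a := by
    intro e a ha
    rw [rowType, Finsupp.finsetSum_apply, Fintype.card_subtype, Finset.card_filter]
    refine Finset.sum_congr rfl fun j _ => ?_
    by_cases hj : e j = a
    · subst hj
      simp [ha]
    · by_cases hj0 : e j = 0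
      · simp [hj0, ha.symm]
      · simp [hj, hj0]
  have hcard : ∀ a, Fintype.card {j // e j = a} = Fintype.card {j // e' j = a} := by
    intro a
    by_cases ha : a = 0
    · subst ha
      have p1 := h0 e
      have p2 := h0 e'
      rw [h] at p1
      omega
    · rw [h1 e a ha, h1 e' a ha, h]
  exact ⟨Equiv.ofFiberEquiv fun a => Fintype.equivOfCardEq (hcard a),
    funext fun j => Equiv.ofFiberEquiv_map _ j⟩

/-- Expanding the product chooses a row for each j: X_α counts the rows equal to α, and the constant
term 1 stands for the zero row. The coefficients are thus orbit sums of monomials. -/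
theorem coeff_norm_one_add_sum (F : Finset (Fin m → ℕ)) (hF : 0 ∈ F) (κ : (Fin m → ℕ) →₀ ℕ) :
    coeff κ (norm K n id (1 + ∑ α ∈ F.erase 0, X α)) =
      ∑ e ∈ Fintype.piFinset fun _ : Fin n => F with rowType e = κ,
        ∏ j, monomialAt K m n (e j) j := by
  classical
  have h : ∀ j : Fin n, substAt K n id j (1 + ∑ α ∈ F.erase 0, X α) =
      ∑ α ∈ F, monomial (if α = 0 then 0 else Finsupp.single α 1) (monomialAt K m n α j) := by
    intro j
    rw [← Finset.add_sum_erase F _ hF, map_add, map_one, map_sum]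
    congr 1
    · simp [monomialAt_zero]
    · refine Finset.sum_congr rfl fun α hα => ?_
      rw [if_neg (Finset.ne_of_mem_erase hα), X, substAt_monomial, weight_single]
      simp
  simp only [norm_apply, h]
  rw [Finset.prod_univ_sum, coeff_sum, Finset.sum_filter]
  refine Finset.sum_congr rfl fun e _ => ?_
  rw [← monomial_sum_prod, coeff_monomial]
  rfl

theorem invariants_le_of_sigma_mem (S : Subalgebra K (CoordRing K m n))
    (hS : ∀ r α, sigma K m n r α ∈ S) : invariants K m n ≤ S := by
  classical
  intro f hf
  have hbelow : ∀ d, sigmaBelow K m n d ≤ S := fun d => Algebra.adjoin_le fun g hg => by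
    obtain ⟨r, α, -, rfl⟩ := hg
    exact hS r α
  let F : Finset (Fin m → ℕ) := Fintype.piFinset fun _ => Finset.range (f.totalDegree + 1)
  have hF : (0 : Fin m → ℕ) ∈ F := by simp [F]
  let T : Finset (Fin n → Fin m → ℕ) := Fintype.piFinset fun _ => F
  have hsum : f = ∑ e ∈ T, C (coeff (rowsExponent e) f) * ∏ j, monomialAt K m n (e j) j := by
    ext v
    obtain ⟨e₀, rfl⟩ := rowsExponent.surjective v
    rw [coeff_sum]
    simp only [prod_monomialAt, C_mul_monomial, mul_one, coeff_monomial,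
      EmbeddingLike.apply_eq_iff_eq]
    rw [Finset.sum_ite_eq']
    split_ifs with he
    · rfl
    · by_contra hne
      refine he ?_
      simp only [T, F, Fintype.mem_piFinset, Finset.mem_range]
      intro j i
      have h1 := le_totalDegree (mem_support_iff.2 hne)
      have h2 := Finsupp.le_degree (i, j) (rowsExponent e₀)
      rw [rowsExponent_apply] at h2
      exact Nat.lt_succ_of_le (h2.trans h1)
  rw [hsum, ← Finset.sum_fiberwise_of_maps_to (t := T.image rowType) (g := rowType)
    fun e he => Finset.mem_image_of_mem _ he]
  refine sum_mem fun κ hκ => ?_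
  obtain ⟨e₀, he₀, rfl⟩ := Finset.mem_image.1 hκ
  have hfib : ∑ e ∈ T with rowType e = rowType e₀,
      C (coeff (rowsExponent e) f) * ∏ j, monomialAt K m n (e j) j =
      C (coeff (rowsExponent e₀) f) *
        coeff (rowType e₀) (norm K n id (1 + ∑ α ∈ F.erase 0, X α)) := by
    rw [coeff_norm_one_add_sum F hF, Finset.mul_sum]
    refine Finset.sum_congr rfl fun e he => ?_
    obtain ⟨π, rfl⟩ := exists_perm_of_rowType_eq (Finset.mem_filter.1 he).2
    rw [coeff_rowsExponent_comp hf]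
  rw [hfib]
  refine mul_mem (S.algebraMap_mem _) (hbelow _ (coeff_norm_mem id ?_ _))
  rw [← constantCoeff_eq]
  simp

theorem permAct_specialize (π : Equiv.Perm (Fin n)) (α : Fin m → ℕ) (f : MvPolynomial (Fin n) ℤ) :
    permAct K m n π (specialize K n α f) = specialize K n α (rename π f) := by
  have h : ((permAct K m n π : CoordRing K m n →+* CoordRing K m n)).comp (specialize K n α) =
      (specialize K n α).comp (rename π : MvPolynomial (Fin n) ℤ →ₐ[ℤ] _) := by
    refine MvPolynomial.ringHom_ext (fun c => by simp) fun j => ?_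
    simp [specialize, permAct, monomialAt]
  exact DFunLike.congr_fun h f

theorem sigma_mem_invariants (r : ℕ) (α : Fin m → ℕ) : sigma K m n r α ∈ invariants K m n := by
  intro π
  rw [← specialize_esymm, permAct_specialize, rename_esymm]

theorem isHomogeneous_sigma (r : ℕ) (α : Fin m → ℕ) :
    (sigma K m n r α).IsHomogeneous (r * ∑ i, α i) := by
  refine IsHomogeneous.sum _ _ _ fun s hs => ?_
  rw [← (Finset.mem_powersetCard.1 hs).2, ← smul_eq_mul, ← Finset.sum_const]
  refine IsHomogeneous.prod _ _ _ fun j _ => IsHomogeneous.prod _ _ _ fun i _ => ?_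
  exact isHomogeneous_X_pow _ _

/-- If `S` contains the `σ_n(x(i))` and the `σ_r(w)` with `w` primitive of degree less than `n / r`
in each vector, then it contains all `σ_r(w)`. -/
theorem sigmaBelow_le (S : Subalgebra K (CoordRing K m n))
    (h₁ : ∀ i, sigma K m n n (Pi.single i 1) ∈ S)
    (h₂ : ∀ (r : ℕ) (α : Fin m → ℕ), 1 ≤ r → r ≤ n → (∀ j, r * α j < n) → Finset.univ.gcd α = 1 →
      sigma K m n r α ∈ S) (d : ℕ) : sigmaBelow K m n d ≤ S := by
  induction d with
  | zero => exact Algebra.adjoin_le fun f ⟨r, α, h, _⟩ => absurd h (Nat.not_lt_zero _)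
  | succ d ih =>
    have hprim : ∀ (r : ℕ) (α : Fin m → ℕ), 1 ≤ r → r * ∑ i, α i ≤ d → Finset.univ.gcd α = 1 →
        sigma K m n r α ∈ S := by
      intro r α hr hd hgcd
      by_cases hrn : n < r
      · rw [sigma_eq_zero hrn]; exact zero_mem _
      by_cases hall : ∀ j, r * α j < n
      · exact h₂ r α hr (not_lt.1 hrn) hall hgcd
      push Not at hall
      obtain ⟨i, hi⟩ := hall
      by_cases hex : ∃ i', i' ≠ i ∧ α i' ≠ 0
      · obtain ⟨i', hne, hα⟩ := hex
        exact ih (sigmaBelow_mono hd (sigma_mem_sigmaBelow_of_le hne hα hr hi))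
      · push Not at hex
        -- Here w is a power of x(i), so primitivity forces w = x(i), and then r = n.
        have hdvd : α i ∣ 1 := by
          rw [← hgcd]
          refine Finset.dvd_gcd fun l _ => ?_
          by_cases hl : l = i
          · rw [hl]
          · rw [hex l hl]; exact dvd_zero _
        have hαi : α i = 1 := Nat.dvd_one.1 hdvd
        have hα : α = Pi.single i 1 := by
          funext l
          by_cases hl : l = i
          · rw [hl, hαi, Pi.single_eq_same]
          · rw [hex l hl, Pi.single_eq_of_ne hl]
        rw [hαi, mul_one] at hi
        obtain rfl : r = n := le_antisymm (not_lt.1 hrn) hi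
        rw [hα]
        exact h₁ i
    refine Algebra.adjoin_le ?_
    rintro _ ⟨r, β, hβ, rfl⟩
    rcases Nat.eq_zero_or_pos r with rfl | hr
    · simp [sigma]
    by_cases hβ0 : β = 0
    · subst hβ0
      simp only [sigma, monomialAt_zero, Finset.prod_const_one]
      exact sum_mem fun _ _ => one_mem _
    obtain ⟨i, hi⟩ := Function.ne_iff.1 hβ0
    obtain ⟨α, hα, hgcd⟩ := Finset.extract_gcd β (s := Finset.univ) ⟨i, Finset.mem_univ i⟩
    set h := Finset.univ.gcd β
    have hβα : β = h • α := funext fun l => hα l (Finset.mem_univ l)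
    have hh : 0 < h := by
      refine Nat.pos_of_ne_zero fun h0 => hβ0 ?_
      rw [hβα, h0, zero_smul]
    have hα0 : α ≠ 0 := by
      rintro rfl
      exact hβ0 (by rw [hβα, smul_zero])
    rw [hβα, sum_smul] at hβ
    have hd : h * r * ∑ i, α i ≤ d := by
      rw [show h * r * ∑ i, α i = r * (h * ∑ i, α i) by ring]
      omega
    have h3 := ih (sigmaBelow_mono hd (sigma_smul_sub_mem (K := K) (n := n) hα0 hh hr))
    rw [hβα, ← sub_add_cancel (sigma K m n r (h • α))
      ((-1) ^ (h * r + r) * (h : CoordRing K m n) * sigma K m n (h * r) α)]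
    exact add_mem h3 (mul_mem (mul_mem (neg_one_pow_mem _ _) (natCast_mem _ _))
      (hprim _ _ (Nat.mul_pos hh hr) hd hgcd))

theorem natCast_lt_div_iff {r : ℕ} (hr : 1 ≤ r) (a : ℕ) :
    (a : ℚ) < (n : ℚ) / (r : ℚ) ↔ r * a < n := by
  rw [lt_div_iff₀ (by exact_mod_cast hr), mul_comm]
  exact_mod_cast Iff.rfl

variable (K m n) in
/-- Generators of the algebra of multisymmetric polynomials. -/
theorem adjoin_sigma_eq_invariants :
    Algebra.adjoin K
        ({f | ∃ i : Fin m, f = sigma K m n n (Pi.single i 1)} ∪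
          {f | ∃ (r : ℕ) (α : Fin m → ℕ), 1 ≤ r ∧ r ≤ n ∧ (∀ j, (α j : ℚ) < (n : ℚ) / (r : ℚ)) ∧
            Finset.univ.gcd α = 1 ∧ f = sigma K m n r α}) = invariants K m n := by
  apply le_antisymm
  · refine Algebra.adjoin_le ?_
    rintro _ (⟨i, rfl⟩ | ⟨r, α, -, -, -, -, rfl⟩) <;> exact sigma_mem_invariants _ _
  · refine invariants_le_of_sigma_mem _ fun r α => ?_
    refine sigmaBelow_le _ (fun i => Algebra.subset_adjoin (Or.inl ⟨i, rfl⟩)) (fun r α hr hrn h hg =>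
      Algebra.subset_adjoin (Or.inr ⟨r, α, hr, hrn, fun j => (natCast_lt_div_iff hr _).2 (h j), hg,
        rfl⟩)) _ (sigma_mem_sigmaBelow (Nat.lt_succ_self _))

end Generation

end Multisymmetric

theorem mainTheorem6 (K : Type*) [CommRing K] (m n : ℕ) :
    Algebra.adjoin K
        ({f | ∃ i : Fin m, f = Multisymmetric.sigma K m n n (Pi.single i 1)} ∪
          {f | ∃ (r : ℕ) (α : Fin m → ℕ), 1 ≤ r ∧ r ≤ n ∧ (∀ j, (α j : ℚ) < (n : ℚ) / (r : ℚ)) ∧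
            Finset.univ.gcd α = 1 ∧ f = Multisymmetric.sigma K m n r α}) =
      Multisymmetric.invariants K m n ∧
    Algebra.adjoin K
        {f | f ∈ Multisymmetric.invariants K m n ∧
          ∃ d : ℕ, (d : ℤ) ≤ max ((m : ℤ) * ((n : ℤ) - 1)) (n : ℤ) ∧ f.IsHomogeneous d} =
      Multisymmetric.invariants K m n := by
  refine ⟨Multisymmetric.adjoin_sigma_eq_invariants K m n, le_antisymm
    (Algebra.adjoin_le fun f hf => hf.1) ?_⟩
  conv_lhs => rw [← Multisymmetric.adjoin_sigma_eq_invariants K m n]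
  refine Algebra.adjoin_mono ?_
  rintro _ (⟨i, rfl⟩ | ⟨r, α, hr, -, hα, -, rfl⟩)
  · refine ⟨Multisymmetric.sigma_mem_invariants _ _, n * ∑ l, (Pi.single i 1 : Fin m → ℕ) l, ?_,
      Multisymmetric.isHomogeneous_sigma _ _⟩
    simp
  · refine ⟨Multisymmetric.sigma_mem_invariants _ _, r * ∑ l, α l, le_max_of_le_left ?_,
      Multisymmetric.isHomogeneous_sigma _ _⟩
    push_cast
    rw [Finset.mul_sum]
    -- Each of the m summands satisfies r α_l < n, hence r α_l ≤ n - 1.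
    refine (Finset.sum_le_card_nsmul _ _ ((n : ℤ) - 1) fun l _ => ?_).trans (by simp)
    have := (Multisymmetric.natCast_lt_div_iff hr _).1 (hα l)
    have : (r : ℤ) * (α l : ℤ) < n := by exact_mod_cast this
    omega
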